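/- Let $R$ be an associative ring with identity; all modules are unitary. A left $R$-module $M$ is *Gorenstein flat* if there is an exact sequence of flat left $R$-modules $$\cdots\to F_1\to F_0\to F^0\to F^1\to\cdots$$ with $M\cong \operatorname{Im}(F_0\to F^0)$ which remains exact after applying $I\otimes_R-$ for every injective right $R$-module $I$. The ring $R$ is *left GF-closed* if for every short exact sequence $0\to A\to B\to C\to 0$ of left $R$-modules with $A$ and $C$ Gorenstein flat, $B$ is Gorenstein flat. The *Gorenstein flat dimension* $\mathrm{Gfd}_R(M)\in\mathbb N\cup\{\infty\}$ is the least $n\ge 0$ for which there is an exact sequence $0\to G_n\to\cdots\to G_0\to M\to 0$ of left $R$-modules with all $G_i$ Gorenstein flat, and $\infty$ if there is none. Write $\mathrm{id}$ for the injective dimension of a right $R$-module. **Theorem.** Let $R$ be a left GF-closed ring and let $M$ be a left $R$-module. For every integer $n\ge 0$ the following are equivalent: 1. $\mathrm{Gfd}_R(M)\le n$; 2. $\mathrm{Gfd}_R(M)<\infty$ and $\mathrm{Tor}^R_i(I,M)=0$ for all $i>n$ and all injective right $R$-modules $I$; 3. $\mathrm{Gfd}_R(M)<\infty$ and $\mathrm{Tor}^R_i(E,M)=0$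 for all $i>n$ and all right $R$-modules $E$ with $\mathrm{id}(E)<\infty$; 4. for every exact sequence of left $R$-modules $0\to K_n\to G_{n-1}\to\cdots\to G_0\to M\to 0$ (for $n=0$: $0\to K_0\to M\to 0$), if each $G_i$ is Gorenstein flat, then so is $K_n$. Furthermore, if $\mathrm{Gfd}_R(M)<\infty$, then $$\begin{aligned}\mathrm{Gfd}_R(M)&=\sup\{i\in\mathbb N \mid \mathrm{Tor}^R_i(E,M)\ne 0\text{ for some right $R$-module }E\text{ with }\mathrm{id}(E)<\infty\}\\&=\sup\{i\in\mathbb N\mid \mathrm{Tor}^R_i(I,M)\ne 0\text{ for some injective right $R$-module }I\},\end{aligned}$$ where $\mathbb N=\{0,1,2,\dots\}$ and the supremum of the empty set is $0$. -/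

import Mathlib

open CategoryTheory

open scoped TensorProduct

universe u

namespace GFDim

/-! Left modules over a ring `R` are `Module R`; right modules are `Module Rᵐᵒᵖ`, the right
action `x · r` being `MulOpposite.op r • x`. -/

section Tensor

variable (R : Type u) [Ring R]

/-- The subgroup of `N ⊗ M` (over the integers) generated by the elements
`(x · r) ⊗ m - x ⊗ (r • m)`. -/
def balancing (N M : Type u) [AddCommGroup N] [Module Rᵐᵒᵖ N] [AddCommGroup M] [Module R M] :
    AddSubgroup (N ⊗[ℤ] M) :=
  AddSubgroup.closure
    {t | ∃ (x : N) (r : R) (m : M), t = (MulOpposite.op r • x) ⊗ₜ[ℤ] m - x ⊗ₜ[ℤ] (r • m)}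

/-- The tensor product of a right module `N` and a left module `M` over a (not necessarily
commutative) ring `R`, an abelian group. -/
abbrev Tensor (N M : Type u) [AddCommGroup N] [Module Rᵐᵒᵖ N] [AddCommGroup M] [Module R M] :
    Type u :=
  (N ⊗[ℤ] M) ⧸ balancing R N M

variable {N N' N'' M M' M'' : Type u}
  [AddCommGroup N] [Module Rᵐᵒᵖ N] [AddCommGroup N'] [Module Rᵐᵒᵖ N']
  [AddCommGroup N''] [Module Rᵐᵒᵖ N'']
  [AddCommGroup M] [Module R M] [AddCommGroup M'] [Module R M'] [AddCommGroup M''] [Module R M'']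

/-- The class of the pure tensor `x ⊗ m`. -/
def tmk (x : N) (m : M) : Tensor R N M := QuotientAddGroup.mk (x ⊗ₜ[ℤ] m)

/-- The tensor product over the integers of two linear maps, as an additive map. -/
def intMap (f : N →ₗ[Rᵐᵒᵖ] N') (g : M →ₗ[R] M') : N ⊗[ℤ] M →+ N' ⊗[ℤ] M' :=
  (TensorProduct.map f.toAddMonoidHom.toIntLinearMap g.toAddMonoidHom.toIntLinearMap).toAddMonoidHom

theorem balancing_le_comap (f : N →ₗ[Rᵐᵒᵖ] N') (g : M →ₗ[R] M') :
    balancing R N M ≤ (balancing R N' M').comap (intMap R f g) := by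
  refine (AddSubgroup.closure_le _).2 ?_
  rintro t ⟨x, r, m, rfl⟩
  refine AddSubgroup.subset_closure ⟨f x, r, g m, ?_⟩
  simp [intMap]

/-- The additive map `f ⊗ g`. -/
def tmap (f : N →ₗ[Rᵐᵒᵖ] N') (g : M →ₗ[R] M') : Tensor R N M →+ Tensor R N' M' :=
  QuotientAddGroup.map _ _ (intMap R f g) (balancing_le_comap R f g)

@[simp]
theorem tmap_tmk (f : N →ₗ[Rᵐᵒᵖ] N') (g : M →ₗ[R] M') (x : N) (m : M) :
    tmap R f g (tmk R x m) = tmk R (f x) (g m) := rfl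

@[simp]
theorem tmk_add (x : N) (m m' : M) : tmk R x (m + m') = tmk R x m + tmk R x m' := by
  simp only [tmk, TensorProduct.tmul_add]; rfl

theorem tensor_hom_ext {A : Type*} [AddCommGroup A] {φ ψ : Tensor R N M →+ A}
    (h : ∀ (x : N) (m : M), φ (tmk R x m) = ψ (tmk R x m)) : φ = ψ := by
  refine DFunLike.ext _ _ fun t => ?_
  obtain ⟨t, rfl⟩ := QuotientAddGroup.mk_surjective t
  induction t using TensorProduct.induction_on with
  | zero => exact (map_zero φ).trans (map_zero ψ).symm
  | tmul x m => exact h x m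
  | add a b ha hb => rw [QuotientAddGroup.mk_add, map_add, map_add, ha, hb]

theorem tmap_id : tmap R (LinearMap.id : N →ₗ[Rᵐᵒᵖ] N) (LinearMap.id : M →ₗ[R] M) =
    AddMonoidHom.id _ :=
  tensor_hom_ext R fun _ _ => rfl

theorem tmap_comp (f : N →ₗ[Rᵐᵒᵖ] N') (f' : N' →ₗ[Rᵐᵒᵖ] N'') (g : M →ₗ[R] M')
    (g' : M' →ₗ[R] M'') :
    tmap R (f' ∘ₗ f) (g' ∘ₗ g) = (tmap R f' g').comp (tmap R f g) :=
  tensor_hom_ext R fun _ _ => rfl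

theorem tmap_add_right (f : N →ₗ[Rᵐᵒᵖ] N') (g g' : M →ₗ[R] M') :
    tmap R f (g + g') = tmap R f g + tmap R f g' :=
  tensor_hom_ext R fun x m => tmk_add R (f x) (g m) (g' m)

end Tensor

section Tor

variable (R : Type u) [Ring R] (N : Type u) [AddCommGroup N] [Module Rᵐᵒᵖ N]

/-- The functor `N ⊗_R -` from left `R`-modules to abelian groups. -/
def tensorFunctor : ModuleCat.{u} R ⥤ AddCommGrpCat.{u} where
  obj M := AddCommGrpCat.of (Tensor R N M)
  map g := AddCommGrpCat.ofHom (tmap R LinearMap.id g.hom)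
  map_id M := by
    rw [ModuleCat.hom_id, tmap_id]; rfl
  map_comp g g' := by
    rw [ModuleCat.hom_comp, ← AddCommGrpCat.ofHom_comp, ← tmap_comp, LinearMap.comp_id]

instance : (tensorFunctor R N).Additive where
  map_add {M M' g g'} := by
    change AddCommGrpCat.ofHom (tmap R LinearMap.id (g + g').hom) = _
    rw [ModuleCat.hom_add, tmap_add_right]; rfl

/-- `Tor_i^R(N, M)`: the value at the left module `M` of the `i`-th left derived functor of
`N ⊗_R -`. -/
noncomputable def Tor (i : ℕ) (M : Type u) [AddCommGroup M] [Module R M] : AddCommGrpCat.{u} :=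
  ((tensorFunctor R N).leftDerived i).obj (ModuleCat.of R M)

end Tor

section GorensteinFlat

variable (R : Type u) [Ring R]

/-- A left module `F` is flat if `- ⊗_R F` preserves injectivity of homomorphisms of right
modules. -/
def IsFlat (F : Type u) [AddCommGroup F] [Module R F] : Prop :=
  ∀ (N N' : Type u) [AddCommGroup N] [Module Rᵐᵒᵖ N] [AddCommGroup N'] [Module Rᵐᵒᵖ N']
    (f : N →ₗ[Rᵐᵒᵖ] N'), Function.Injective f →
      Function.Injective (tmap R f (LinearMap.id : F →ₗ[R] F))

/-- A left module `M` is Gorenstein flat if there is an exact sequence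
`⋯ → F (-2) → F (-1) → F 0 → F 1 → ⋯` of flat left modules that stays exact after applying
`I ⊗_R -` for each injective right module `I`, and such that `M` is isomorphic to the image of
`F (-1) → F 0`. -/
def IsGorensteinFlat (M : Type u) [AddCommGroup M] [Module R M] : Prop :=
  ∃ (F : ℤ → ModuleCat.{u} R) (d : ∀ i, F i →ₗ[R] F (i + 1)),
    (∀ i, IsFlat R (F i)) ∧
    (∀ i, Function.Exact (d i) (d (i + 1))) ∧
    (∀ (I : Type u) [AddCommGroup I] [Module Rᵐᵒᵖ I], Module.Injective Rᵐᵒᵖ I →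
      ∀ i, Function.Exact (tmap R (LinearMap.id : I →ₗ[Rᵐᵒᵖ] I) (d i))
        (tmap R (LinearMap.id : I →ₗ[Rᵐᵒᵖ] I) (d (i + 1)))) ∧
    Nonempty (M ≃ₗ[R] LinearMap.range (d (-1)))

/-- A ring is left GF-closed if the class of Gorenstein flat left modules is closed under
extensions. -/
def IsLeftGFClosed : Prop :=
  ∀ (A B C : Type u) [AddCommGroup A] [Module R A] [AddCommGroup B] [Module R B]
    [AddCommGroup C] [Module R C] (f : A →ₗ[R] B) (g : B →ₗ[R] C),
    Function.Injective f → Function.Exact f g → Function.Surjective g →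
    IsGorensteinFlat R A → IsGorensteinFlat R C → IsGorensteinFlat R B

/-- An exact sequence `0 → G n → ⋯ → G 1 → G 0 → M → 0` of left modules, extended to the left
by zero modules `G i`, `i > n`. -/
structure ExactSeq (M : Type u) [AddCommGroup M] [Module R M] (n : ℕ) where
  G : ℕ → ModuleCat.{u} R
  d : ∀ i, G (i + 1) →ₗ[R] G i
  aug : G 0 →ₗ[R] M
  aug_surjective : Function.Surjective aug
  exact_zero : Function.Exact (d 0) aug
  exact_succ : ∀ i, Function.Exact (d (i + 1)) (d i)
  subsingleton_of_gt : ∀ i, n < i → Subsingleton (G i)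

/-- `M` has a Gorenstein flat resolution of length `n`. -/
def HasGFResolution (M : Type u) [AddCommGroup M] [Module R M] (n : ℕ) : Prop :=
  ∃ S : ExactSeq R M n, ∀ i, i ≤ n → IsGorensteinFlat R (S.G i)

/-- The Gorenstein flat dimension of `M`: the least length of a Gorenstein flat resolution of
`M`, and `⊤` if there is none. -/
noncomputable def gfd (M : Type u) [AddCommGroup M] [Module R M] : ℕ∞ :=
  ⨅ (n : ℕ) (_ : HasGFResolution R M n), (n : ℕ∞)

end GorensteinFlat

end GFDim

/-!
The proof works with short exact sequences of modules and with the injectivity of maps between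
tensor products; the derived functor is only met in `isZero_tor_succ_iff`.

*Tor.* The vanishing of `Tor_{i+1}(N, M)` is expressed by `TorZero`, which resolves the right
module `N`. A single diagram chase, `injective_of_snake`, then yields dimension shifting in the left
module (`IsSES.torZero_zero_iff`, `IsSES.torZero_succ_iff`), in the right module
(`IsSES.torZero_of_right`), and the comparison with a projective resolution of `M`. Dimension
shifting in the right module passes from injective modules to modules of finite injective dimension.

*Gorenstein flat modules.* A module `A` is Gorenstein flat as soon as there is an exact sequence
`0 → A → F → G → 0` with `F` flat and `G` Gorenstein flat (`IsSES.isGorensteinFlat_left`). If the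
class is closed under extensions, two consequences follow by pullbacks and pushouts: it is closed
under kernels of epimorphisms (`IsSES.isGorensteinFlat_ker`), and a quotient `C` of Gorenstein flat
modules is Gorenstein flat if `Tor_1(I, C) = 0` for all injective `I`
(`IsSES.isGorensteinFlat_right`). For the latter, `C` is embedded with Gorenstein flat cokernel in a
quotient `H` of flat modules; the hypothesis on Tor passes to `H`, and it forces `H` to be flat
because every right module embeds in an injective one.

*Dimension.* Closure under kernels shows that every first syzygy `K` in `0 → K → G → M → 0` with `G`
Gorenstein flat lowers the dimension (`IsSES.hasGFResolution_ker`), so that the length of a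
resolution does not depend on the choices; closure under quotients shows that a module of finite
dimension with vanishing Tor is Gorenstein flat. Induction along syzygies gives the equivalences,
and the formulas for the dimension follow by comparing upper bounds.
-/

namespace GFDim

/-! ### Short exact sequences of modules -/

/-- `0 → A → B → C → 0`, with maps `f` and `g`, is exact. -/
structure IsSES {S : Type*} [Ring S] {A B C : Type*} [AddCommGroup A] [Module S A]
    [AddCommGroup B] [Module S B] [AddCommGroup C] [Module S C]
    (f : A →ₗ[S] B) (g : B →ₗ[S] C) : Prop where
  injective : Function.Injective f
  exact : Function.Exact f g
  surjective : Function.Surjective g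

section SES

variable {S : Type u} [Ring S] {A B C D F K L P G X : Type u}
  [AddCommGroup A] [Module S A] [AddCommGroup B] [Module S B] [AddCommGroup C] [Module S C]
  [AddCommGroup D] [Module S D] [AddCommGroup F] [Module S F] [AddCommGroup K] [Module S K]
  [AddCommGroup L] [Module S L] [AddCommGroup P] [Module S P] [AddCommGroup G] [Module S G]
  [AddCommGroup X] [Module S X]

theorem IsSES.apply_apply {f : A →ₗ[S] B} {g : B →ₗ[S] C} (h : IsSES f g) (a : A) :
    g (f a) = 0 := (h.exact _).2 ⟨a, rfl⟩

theorem isSES_subtype_ker {g : B →ₗ[S] C} (hg : Function.Surjective g) :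
    IsSES (LinearMap.ker g).subtype g :=
  ⟨Subtype.val_injective, LinearMap.exact_subtype_ker_map g, hg⟩

theorem isSES_mkQ_range {f : A →ₗ[S] B} (hf : Function.Injective f) :
    IsSES f (LinearMap.range f).mkQ :=
  ⟨hf, LinearMap.exact_map_mkQ_range f, Submodule.mkQ_surjective _⟩

theorem IsSES.exists_pullback {f : A →ₗ[S] B} {g : B →ₗ[S] C} {k : K →ₗ[S] F} {h : F →ₗ[S] C}
    (hfg : IsSES f g) (hkh : IsSES k h) :
    ∃ (D : ModuleCat.{u} S) (a : A →ₗ[S] D) (b : D →ₗ[S] F) (c : K →ₗ[S] D) (e : D →ₗ[S] B),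
      IsSES a b ∧ IsSES c e := by
  let D := LinearMap.eqLocus (g ∘ₗ LinearMap.fst S B F) (h ∘ₗ LinearMap.snd S B F)
  refine ⟨ModuleCat.of S D,
    (LinearMap.inl S B F ∘ₗ f).codRestrict D fun a => ?_, LinearMap.snd S B F ∘ₗ D.subtype,
    (LinearMap.inr S B F ∘ₗ k).codRestrict D fun a => ?_, LinearMap.fst S B F ∘ₗ D.subtype,
    ⟨fun a a' haa => hfg.injective (congrArg (fun d : D => d.1.1) haa), ?_, fun y => ?_⟩,
    ⟨fun a a' haa => hkh.injective (congrArg (fun d : D => d.1.2) haa), ?_, fun y => ?_⟩⟩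
  · simp [D, LinearMap.mem_eqLocus, hfg.apply_apply]
  · simp [D, LinearMap.mem_eqLocus, hkh.apply_apply]
  · rintro ⟨⟨x, y⟩, hxy⟩
    have hxy : g x = h y := hxy
    constructor
    · rintro (rfl : y = 0)
      rw [map_zero] at hxy
      obtain ⟨a, rfl⟩ := (hfg.exact x).1 hxy
      exact ⟨a, rfl⟩
    · rintro ⟨a, ha⟩
      exact (congrArg (fun d : D => d.1.2) ha).symm
  · obtain ⟨x, hx⟩ := hfg.surjective (h y)
    exact ⟨⟨(x, y), hx⟩, rfl⟩
  · rintro ⟨⟨x, y⟩, hxy⟩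
    have hxy : g x = h y := hxy
    constructor
    · rintro (rfl : x = 0)
      rw [map_zero] at hxy
      obtain ⟨a, rfl⟩ := (hkh.exact y).1 hxy.symm
      exact ⟨a, rfl⟩
    · rintro ⟨a, ha⟩
      exact (congrArg (fun d : D => d.1.1) ha).symm
  · obtain ⟨x, hx⟩ := hkh.surjective (g y)
    exact ⟨⟨(y, x), hx.symm⟩, rfl⟩

theorem IsSES.exists_pushout {f : A →ₗ[S] B} {g : B →ₗ[S] C} {k : A →ₗ[S] F} {h : F →ₗ[S] G}
    (hfg : IsSES f g) (hkh : IsSES k h) :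
    ∃ (D : ModuleCat.{u} S) (a : B →ₗ[S] D) (b : D →ₗ[S] G) (c : F →ₗ[S] D) (e : D →ₗ[S] C),
      IsSES a b ∧ IsSES c e := by
  let W := LinearMap.range (f.prod k)
  refine ⟨ModuleCat.of S ((B × F) ⧸ W), W.mkQ ∘ₗ LinearMap.inl S B F,
    W.liftQ (h ∘ₗ LinearMap.snd S B F) ?_, W.mkQ ∘ₗ LinearMap.inr S B F,
    W.liftQ (g ∘ₗ LinearMap.fst S B F) ?_,
    ⟨(injective_iff_map_eq_zero _).2 fun x hx => ?_, fun t => ?_, fun y => ?_⟩,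
    ⟨(injective_iff_map_eq_zero _).2 fun x hx => ?_, fun t => ?_, fun y => ?_⟩⟩
  · rintro _ ⟨a, rfl⟩
    exact hkh.apply_apply a
  · rintro _ ⟨a, rfl⟩
    exact hfg.apply_apply a
  · obtain ⟨a, ha⟩ := (Submodule.Quotient.mk_eq_zero W).1 hx
    have h2 : k a = 0 := congrArg Prod.snd ha
    have h1 : f a = x := congrArg Prod.fst ha
    rw [← h1, hkh.injective (h2.trans (map_zero k).symm), map_zero]
  · obtain ⟨⟨x, y⟩, rfl⟩ := W.mkQ_surjective t
    constructor
    · intro (ht : h y = 0)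
      obtain ⟨a, rfl⟩ := (hkh.exact y).1 ht
      refine ⟨x - f a, (Submodule.Quotient.eq W).2 ⟨-a, ?_⟩⟩
      simp
    · rintro ⟨b, hb⟩
      rw [← hb]
      exact map_zero h
  · obtain ⟨z, rfl⟩ := hkh.surjective y
    exact ⟨W.mkQ (0, z), rfl⟩
  · obtain ⟨a, ha⟩ := (Submodule.Quotient.mk_eq_zero W).1 hx
    have h2 : f a = 0 := congrArg Prod.fst ha
    have h1 : k a = x := congrArg Prod.snd ha
    rw [← h1, hfg.injective (h2.trans (map_zero f).symm), map_zero]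
  · obtain ⟨⟨x, y⟩, rfl⟩ := W.mkQ_surjective t
    constructor
    · intro (ht : g x = 0)
      obtain ⟨a, rfl⟩ := (hfg.exact x).1 ht
      refine ⟨y - k a, (Submodule.Quotient.eq W).2 ⟨-a, ?_⟩⟩
      simp
    · rintro ⟨b, hb⟩
      rw [← hb]
      exact map_zero g
  · obtain ⟨z, rfl⟩ := hfg.surjective y
    exact ⟨W.mkQ (z, 0), rfl⟩

/-- For submodules `A ⊆ D ⊆ F` this is the exact sequence `0 → D / A → F / A → F / D → 0`. -/
theorem IsSES.exists_quotient {a : A →ₗ[S] D} {b : D →ₗ[S] X} {m : D →ₗ[S] F} {q : F →ₗ[S] G}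
    (hab : IsSES a b) (hmq : IsSES m q) :
    ∃ (E : ModuleCat.{u} S) (p : F →ₗ[S] E) (i : X →ₗ[S] E) (r : E →ₗ[S] G),
      IsSES (m ∘ₗ a) p ∧ IsSES i r := by
  let W := LinearMap.range (m ∘ₗ a)
  have hex : Function.Exact a b := hab.exact
  have hle : LinearMap.range a ≤ LinearMap.ker (W.mkQ ∘ₗ m) := by
    rintro _ ⟨y, rfl⟩
    exact (Submodule.Quotient.mk_eq_zero W).2 ⟨y, rfl⟩
  let i : X →ₗ[S] F ⧸ W :=
    (LinearMap.range a).liftQ (W.mkQ ∘ₗ m) hle ∘ₗ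
    (hex.linearEquivOfSurjective hab.surjective).symm.toLinearMap
  have hi : ∀ d, i (b d) = W.mkQ (m d) := by
    intro d
    have : (hex.linearEquivOfSurjective hab.surjective).symm (b d) =
        (LinearMap.range a).mkQ d := by
      rw [LinearEquiv.symm_apply_eq]; rfl
    exact congrArg ((LinearMap.range a).liftQ (W.mkQ ∘ₗ m) hle) this
  refine ⟨ModuleCat.of S (F ⧸ W), W.mkQ, i, W.liftQ q ?_,
    isSES_mkQ_range (hmq.injective.comp hab.injective),
    (injective_iff_map_eq_zero _).2 fun x hx => ?_, fun t => ?_, fun y => ?_⟩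
  · rintro _ ⟨y, rfl⟩
    exact hmq.apply_apply _
  · obtain ⟨d, rfl⟩ := hab.surjective x
    rw [hi] at hx
    obtain ⟨y, hy⟩ := (Submodule.Quotient.mk_eq_zero W).1 hx
    rw [← hmq.injective hy]
    exact hab.apply_apply y
  · obtain ⟨y, rfl⟩ := W.mkQ_surjective t
    constructor
    · intro (ht : q y = 0)
      obtain ⟨d, rfl⟩ := (hmq.exact y).1 ht
      exact ⟨b d, hi d⟩
    · rintro ⟨x, hx⟩
      obtain ⟨d, rfl⟩ := hab.surjective x
      rw [← hx, hi]
      exact hmq.apply_apply d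
  · obtain ⟨z, rfl⟩ := hmq.surjective y
    exact ⟨W.mkQ z, rfl⟩

/-- The preimage of the submodule `K` of `P` under the epimorphism `G → P`. -/
theorem IsSES.exists_preimage {a : A →ₗ[S] G} {b : G →ₗ[S] P} {m : K →ₗ[S] P} {q : P →ₗ[S] X}
    (hab : IsSES a b) (hmq : IsSES m q) :
    ∃ (E : ModuleCat.{u} S) (i : A →ₗ[S] E) (r : E →ₗ[S] K) (j : E →ₗ[S] G),
      IsSES i r ∧ IsSES j (q ∘ₗ b) := by
  let W := LinearMap.ker (q ∘ₗ b)
  let e := LinearEquiv.ofInjective m hmq.injective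
  have hW : ∀ w : W, b w ∈ LinearMap.range m := fun w => (hmq.exact _).1 w.2
  let r : W →ₗ[S] K := e.symm.toLinearMap ∘ₗ (b ∘ₗ W.subtype).codRestrict _ hW
  have hr : ∀ w, m (r w) = b w := fun w =>
    congrArg Subtype.val (e.apply_symm_apply ⟨b w, hW w⟩)
  refine ⟨ModuleCat.of S W, a.codRestrict W fun x => ?_, r, W.subtype,
    ⟨fun x y hxy => hab.injective (congrArg Subtype.val hxy), fun t => ?_, fun y => ?_⟩,
    isSES_subtype_ker (hmq.surjective.comp hab.surjective)⟩
  · simp [W, hab.apply_apply]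
  · constructor
    · intro ht
      obtain ⟨x, hx⟩ := (hab.exact t.1).1 (by rw [← hr, ht, map_zero])
      exact ⟨x, Subtype.ext hx⟩
    · rintro ⟨x, rfl⟩
      exact hmq.injective ((hr _).trans ((hab.apply_apply x).trans (map_zero m).symm))
  · obtain ⟨z, hz⟩ := hab.surjective (m y)
    refine ⟨⟨z, ?_⟩, hmq.injective ?_⟩
    · simp [W, hz, hmq.apply_apply]
    · rw [hr, hz]

/-- The horseshoe lemma in one degree. -/
theorem IsSES.exists_horseshoe {f : L →ₗ[S] P} {g : P →ₗ[S] G} {i : A →ₗ[S] B} {p : B →ₗ[S] L}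
    {j : K →ₗ[S] F} {q : F →ₗ[S] G} [Module.Projective S F]
    (hfg : IsSES f g) (hip : IsSES i p) (hjq : IsSES j q) :
    ∃ (X : ModuleCat.{u} S) (a : X →ₗ[S] B × F) (b : B × F →ₗ[S] P) (c : A →ₗ[S] X)
      (e : X →ₗ[S] K), IsSES a b ∧ IsSES c e := by
  obtain ⟨D, l, r, k, t, hlr, hkt⟩ := hfg.exists_pullback hjq
  obtain ⟨s, hs⟩ := Module.projective_lifting_property r LinearMap.id hlr.surjective
  have hs : ∀ y, r (s y) = y := fun y => LinearMap.congr_fun hs y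
  have hr : ∀ z y, r (l (p z) + s y) = y := fun z y => by
    rw [map_add, hlr.apply_apply, zero_add, hs]
  -- `D` is the direct sum of `L` and `F`, hence a quotient of `B × F` with kernel `A`
  have hD : IsSES (LinearMap.inl S B F ∘ₗ i) ((l ∘ₗ p).coprod s) := by
    refine ⟨fun x y hxy => hip.injective (congrArg Prod.fst hxy), fun ⟨z, y⟩ => ?_, fun x => ?_⟩
    · constructor
      · intro (h : l (p z) + s y = 0)
        have hy : y = 0 := by rw [← hr z y, h, map_zero]
        subst hy
        rw [map_zero, add_zero] at h
        obtain ⟨x, rfl⟩ := (hip.exact z).1 (hlr.injective (h.trans (map_zero l).symm))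
        exact ⟨x, rfl⟩
      · rintro ⟨x, hx⟩
        rw [← hx]
        simp [hip.apply_apply]
    · obtain ⟨y, hy⟩ := (hlr.exact (x - s (r x))).1 (by rw [map_sub, hs, sub_self])
      obtain ⟨z, rfl⟩ := hip.surjective y
      exact ⟨(z, r x), by simp [hy]⟩
  obtain ⟨X, c, e, v, hce, hv⟩ := hD.exists_preimage hkt
  exact ⟨X, v, _, c, e, hv, hce⟩

end SES

/-! ### The balanced tensor product -/

section Tensor

variable (R : Type u) [Ring R] {N N' N'' M K P L : Type u}
  [AddCommGroup N] [Module Rᵐᵒᵖ N] [AddCommGroup N'] [Module Rᵐᵒᵖ N']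
  [AddCommGroup N''] [Module Rᵐᵒᵖ N''] [AddCommGroup M] [Module R M]
  [AddCommGroup K] [Module R K] [AddCommGroup P] [Module R P] [AddCommGroup L] [Module R L]

theorem tmk_add_left (x x' : N) (m : M) : tmk R (x + x') m = tmk R x m + tmk R x' m := by
  simp only [tmk, TensorProduct.add_tmul]; rfl

@[simp]
theorem tmk_zero (x : N) : tmk R x (0 : M) = 0 := by
  simp only [tmk, TensorProduct.tmul_zero]; rfl

@[simp]
theorem zero_tmk (m : M) : tmk R (0 : N) m = 0 := by
  simp only [tmk, TensorProduct.zero_tmul]; rfl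

theorem tmk_smul (x : N) (r : R) (m : M) :
    tmk R (MulOpposite.op r • x) m = tmk R x (r • m) := by
  rw [← sub_eq_zero]
  exact (QuotientAddGroup.eq_zero_iff _).2 (AddSubgroup.subset_closure ⟨x, r, m, rfl⟩)

/-- The additive map on `N ⊗_R M` given by a balanced biadditive map. -/
def tlift {A : Type*} [AddCommGroup A] (b : N →+ M →+ A)
    (hb : ∀ x (r : R) m, b (MulOpposite.op r • x) m = b x (r • m)) : Tensor R N M →+ A :=
  QuotientAddGroup.lift _ (TensorProduct.liftAddHom b fun n x m => by simp) <| by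
    refine (AddSubgroup.closure_le _).2 ?_
    rintro t ⟨x, r, m, rfl⟩
    simp [hb]

@[simp]
theorem tlift_tmk {A : Type*} [AddCommGroup A] (b : N →+ M →+ A)
    (hb : ∀ x (r : R) m, b (MulOpposite.op r • x) m = b x (r • m)) (x : N) (m : M) :
    tlift R b hb (tmk R x m) = b x m := rfl

/-- The map `N ⊗ g` for a map `g` of left modules. -/
abbrev lmap (N : Type u) [AddCommGroup N] [Module Rᵐᵒᵖ N] (g : K →ₗ[R] P) :
    Tensor R N K →+ Tensor R N P :=
  tmap R (LinearMap.id : N →ₗ[Rᵐᵒᵖ] N) g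

/-- The map `f ⊗ M` for a map `f` of right modules. -/
abbrev rmap (f : N →ₗ[Rᵐᵒᵖ] N') (M : Type u) [AddCommGroup M] [Module R M] :
    Tensor R N M →+ Tensor R N' M :=
  tmap R f (LinearMap.id : M →ₗ[R] M)

theorem lmap_lmap (g : K →ₗ[R] P) (h : P →ₗ[R] L) (t : Tensor R N K) :
    lmap R N h (lmap R N g t) = lmap R N (h ∘ₗ g) t :=
  (DFunLike.congr_fun (tmap_comp R LinearMap.id LinearMap.id g h) t).symm

theorem lmap_rmap (f : N →ₗ[Rᵐᵒᵖ] N') (g : K →ₗ[R] P) (t : Tensor R N K) :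
    lmap R N' g (rmap R f K t) = rmap R f P (lmap R N g t) :=
  (DFunLike.congr_fun (tmap_comp R f LinearMap.id LinearMap.id g) t).symm.trans
    (DFunLike.congr_fun (tmap_comp R LinearMap.id f g LinearMap.id) t)

theorem tmap_surjective {f : N →ₗ[Rᵐᵒᵖ] N'} {g : K →ₗ[R] P} (hf : Function.Surjective f)
    (hg : Function.Surjective g) : Function.Surjective (tmap R f g) := by
  intro t
  obtain ⟨t, rfl⟩ := QuotientAddGroup.mk_surjective t
  obtain ⟨s, rfl⟩ := TensorProduct.map_surjective
    (g := f.toAddMonoidHom.toIntLinearMap) hf (g' := g.toAddMonoidHom.toIntLinearMap) hg t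
  exact ⟨QuotientAddGroup.mk s, rfl⟩

theorem balancing_le_map {f : N →ₗ[Rᵐᵒᵖ] N'} {g : K →ₗ[R] P} (hf : Function.Surjective f)
    (hg : Function.Surjective g) :
    balancing R N' P ≤ (balancing R N K).map (intMap R f g) := by
  refine (AddSubgroup.closure_le _).2 ?_
  rintro t ⟨x, r, m, rfl⟩
  obtain ⟨x, rfl⟩ := hf x
  obtain ⟨m, rfl⟩ := hg m
  exact ⟨_, AddSubgroup.subset_closure ⟨x, r, m, rfl⟩, by simp [intMap]⟩

theorem lmap_exact {f : K →ₗ[R] P} {g : P →ₗ[R] L} (hfg : Function.Exact f g)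
    (hg : Function.Surjective g) : Function.Exact (lmap R N f) (lmap R N g) := by
  intro t
  constructor
  · obtain ⟨t, rfl⟩ := QuotientAddGroup.mk_surjective t
    intro ht
    obtain ⟨b, hb, hbt⟩ := balancing_le_map R (f := (LinearMap.id : N →ₗ[Rᵐᵒᵖ] N))
      Function.surjective_id hg ((QuotientAddGroup.eq_zero_iff _).1 ht)
    obtain ⟨s, hs⟩ := (lTensor_exact N (f := f.toAddMonoidHom.toIntLinearMap)
      (g := g.toAddMonoidHom.toIntLinearMap) hfg hg (t - b)).1
        ((map_sub (intMap R (LinearMap.id : N →ₗ[Rᵐᵒᵖ] N) g) t b).trans (sub_eq_zero.2 hbt.symm))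
    refine ⟨QuotientAddGroup.mk s, ?_⟩
    refine (congrArg QuotientAddGroup.mk hs).trans (QuotientAddGroup.eq.2 ?_)
    simpa using hb
  · rintro ⟨s, rfl⟩
    rw [lmap_lmap, hfg.linearMap_comp_eq_zero]
    refine DFunLike.congr_fun (f := lmap R N (0 : K →ₗ[R] L)) (g := 0)
      (tensor_hom_ext R fun x m => ?_) s
    simp

theorem rmap_exact {f : N →ₗ[Rᵐᵒᵖ] N'} {g : N' →ₗ[Rᵐᵒᵖ] N''} (hfg : Function.Exact f g)
    (hg : Function.Surjective g) : Function.Exact (rmap R f M) (rmap R g M) := by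
  intro t
  constructor
  · obtain ⟨t, rfl⟩ := QuotientAddGroup.mk_surjective t
    intro ht
    obtain ⟨b, hb, hbt⟩ := balancing_le_map R (g := (LinearMap.id : M →ₗ[R] M)) hg
      Function.surjective_id ((QuotientAddGroup.eq_zero_iff _).1 ht)
    obtain ⟨s, hs⟩ := (rTensor_exact M (f := f.toAddMonoidHom.toIntLinearMap)
      (g := g.toAddMonoidHom.toIntLinearMap) hfg hg (t - b)).1
        ((map_sub (intMap R g (LinearMap.id : M →ₗ[R] M)) t b).trans (sub_eq_zero.2 hbt.symm))
    refine ⟨QuotientAddGroup.mk s, ?_⟩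
    refine (congrArg QuotientAddGroup.mk hs).trans (QuotientAddGroup.eq.2 ?_)
    simpa using hb
  · rintro ⟨s, rfl⟩
    have h := tmap_comp R f g (LinearMap.id : M →ₗ[R] M) LinearMap.id
    rw [← AddMonoidHom.comp_apply, ← h, hfg.linearMap_comp_eq_zero]
    refine DFunLike.congr_fun (f := rmap R (0 : N →ₗ[Rᵐᵒᵖ] N'') M) (g := 0)
      (tensor_hom_ext R fun x m => ?_) s
    simp

/-- The part of the snake lemma used throughout: in a diagram with exact rows `A → B → C` and
columns `X₁ → X₂ → X₃`, injectivity of `B₁ → B₂` and `A₃ → B₃` gives that of `C₁ → C₂`. -/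
theorem injective_of_snake {A₁ B₁ C₁ A₂ B₂ C₂ A₃ B₃ : Type*} [AddCommGroup A₁] [AddCommGroup B₁]
    [AddCommGroup C₁] [AddCommGroup A₂] [AddCommGroup B₂] [AddCommGroup C₂] [AddCommGroup A₃]
    [AddCommGroup B₃] {f₁ : A₁ →+ B₁} {g₁ : B₁ →+ C₁} {f₂ : A₂ →+ B₂} {g₂ : B₂ →+ C₂}
    {f₃ : A₃ →+ B₃} {a : A₁ →+ A₂} {a' : A₂ →+ A₃} {b : B₁ →+ B₂} {b' : B₂ →+ B₃} {c : C₁ →+ C₂}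
    (hg₁ : Function.Surjective g₁) (h₁ : Function.Exact f₁ g₁) (h₂ : Function.Exact f₂ g₂)
    (ha : Function.Exact a a') (hb : Function.Exact b b')
    (hab : ∀ x, f₂ (a x) = b (f₁ x)) (hab' : ∀ x, f₃ (a' x) = b' (f₂ x))
    (hbc : ∀ x, g₂ (b x) = c (g₁ x)) (hbi : Function.Injective b) (hf₃ : Function.Injective f₃) :
    Function.Injective c := by
  refine (injective_iff_map_eq_zero c).2 fun x hx => ?_
  obtain ⟨y, rfl⟩ := hg₁ x
  obtain ⟨z, hz⟩ := (h₂ (b y)).1 (by rw [hbc, hx])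
  obtain ⟨w, rfl⟩ := (ha z).1 (hf₃ (by rw [hab', hz, (hb (b y)).2 ⟨y, rfl⟩, map_zero]))
  exact (h₁ y).2 ⟨w, hbi (by rw [← hab, hz])⟩

theorem rmap_injective_of_snake {i : K →ₗ[R] P} {p : P →ₗ[R] L} {f : N' →ₗ[Rᵐᵒᵖ] N}
    {g : N →ₗ[Rᵐᵒᵖ] N''} (hip : IsSES i p) (hfg : IsSES f g)
    (hP : Function.Injective (rmap R f P)) (hN'' : Function.Injective (lmap R N'' i)) :
    Function.Injective (rmap R f L) :=
  injective_of_snake (tmap_surjective R Function.surjective_id hip.surjective)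
    (lmap_exact R hip.exact hip.surjective) (lmap_exact R hip.exact hip.surjective)
    (rmap_exact R hfg.exact hfg.surjective) (rmap_exact R hfg.exact hfg.surjective)
    (lmap_rmap R f i) (lmap_rmap R g i) (lmap_rmap R f p) hP hN''

theorem lmap_injective_of_snake {i : K →ₗ[R] P} {p : P →ₗ[R] L} {f : N' →ₗ[Rᵐᵒᵖ] N}
    {g : N →ₗ[Rᵐᵒᵖ] N''} (hip : IsSES i p) (hfg : IsSES f g)
    (hN : Function.Injective (lmap R N i)) (hL : Function.Injective (rmap R f L)) :
    Function.Injective (lmap R N'' i) :=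
  injective_of_snake (tmap_surjective R hfg.surjective Function.surjective_id)
    (rmap_exact R hfg.exact hfg.surjective) (rmap_exact R hfg.exact hfg.surjective)
    (lmap_exact R hip.exact hip.surjective) (lmap_exact R hip.exact hip.surjective)
    (fun t => (lmap_rmap R f i t).symm) (fun t => (lmap_rmap R f p t).symm)
    (fun t => (lmap_rmap R g i t).symm) hN hL

end Tensor

/-! ### Flat modules -/

section Flat

variable (R : Type u) [Ring R] {A B C : Type u} [AddCommGroup A] [Module R A]
  [AddCommGroup B] [Module R B] [AddCommGroup C] [Module R C]

theorem isFlat_finsupp (ι : Type u) : IsFlat R (ι →₀ R) := by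
  intro N N' _ _ _ _ f hf
  let b (X : Type u) [AddCommGroup X] [Module Rᵐᵒᵖ X] : X →+ (ι →₀ R) →+ (ι →₀ X) :=
    AddMonoidHom.mk' (fun x => Finsupp.mapRange.addMonoidHom
      (AddMonoidHom.mk' (fun r => MulOpposite.op r • x) fun r s => by simp [add_smul]))
      fun x y => by ext; simp
  let φ (X : Type u) [AddCommGroup X] [Module Rᵐᵒᵖ X] : Tensor R X (ι →₀ R) →+ (ι →₀ X) :=
    tlift R (b X) fun x r m => by ext; simp [b, mul_smul]
  let ψ : (ι →₀ N) →+ Tensor R N (ι →₀ R) :=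
    Finsupp.liftAddHom fun i => AddMonoidHom.mk' (fun x => tmk R x (Finsupp.single i 1))
      fun x y => tmk_add_left R x y _
  have hψ : ∀ t, ψ (φ N t) = t := fun t => by
    refine DFunLike.congr_fun (f := ψ.comp (φ N)) (g := AddMonoidHom.id _)
      (tensor_hom_ext R fun x m => ?_) t
    induction m using Finsupp.induction_linear with
    | zero => simp
    | add m m' h h' => rw [tmk_add, map_add, map_add, h, h']
    | single i r => simp [ψ, φ, b, Finsupp.sum_single_index, tmk_smul]
  have hφ : ∀ t, φ N' (rmap R f _ t) = (φ N t).mapRange f (map_zero f) := fun t => by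
    refine DFunLike.congr_fun (f := (φ N').comp (rmap R f _))
      (g := (Finsupp.mapRange.addMonoidHom f.toAddMonoidHom).comp (φ N))
      (tensor_hom_ext R fun x m => ?_) t
    ext
    simp [φ, b]
  intro s t hst
  rw [← hψ s, ← hψ t]
  exact congrArg ψ (Finsupp.mapRange_injective f (map_zero f) hf (by rw [← hφ, ← hφ, hst]))

theorem lmap_injective_finsupp (ι : Type u) {f : A →ₗ[R] B} (hf : Function.Injective f) :
    Function.Injective (lmap R (ι →₀ Rᵐᵒᵖ) f) := by
  let b (X : Type u) [AddCommGroup X] [Module R X] : (ι →₀ Rᵐᵒᵖ) →+ X →+ (ι →₀ X) :=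
    AddMonoidHom.mk' (fun s => AddMonoidHom.mk'
      (fun x => s.mapRange (fun r => r.unop • x) (by simp)) fun x y => by ext; simp)
      fun s t => by ext; simp [add_smul]
  let φ (X : Type u) [AddCommGroup X] [Module R X] : Tensor R (ι →₀ Rᵐᵒᵖ) X →+ (ι →₀ X) :=
    tlift R (b X) fun x r m => by ext; simp [b, mul_smul]
  let ψ : (ι →₀ A) →+ Tensor R (ι →₀ Rᵐᵒᵖ) A :=
    Finsupp.liftAddHom fun i => AddMonoidHom.mk' (fun x => tmk R (Finsupp.single i 1) x)
      fun x y => tmk_add R _ x y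
  have hψ : ∀ t, ψ (φ A t) = t := fun t => by
    refine DFunLike.congr_fun (f := ψ.comp (φ A)) (g := AddMonoidHom.id _)
      (tensor_hom_ext R fun s x => ?_) t
    induction s using Finsupp.induction_linear with
    | zero => simp
    | add m m' h h' => rw [tmk_add_left, map_add, map_add, h, h']
    | single i r =>
      simp [ψ, φ, b, Finsupp.sum_single_index, ← tmk_smul, -Finsupp.smul_single]
      simp
  have hφ : ∀ t, φ B (lmap R _ f t) = (φ A t).mapRange f (map_zero f) := fun t => by
    refine DFunLike.congr_fun (f := (φ B).comp (lmap R _ f))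
      (g := (Finsupp.mapRange.addMonoidHom f.toAddMonoidHom).comp (φ A))
      (tensor_hom_ext R fun x m => ?_) t
    ext
    simp [φ, b]
  intro s t hst
  rw [← hψ s, ← hψ t]
  exact congrArg ψ (Finsupp.mapRange_injective f (map_zero f) hf (by rw [← hφ, ← hφ, hst]))

variable {R}

theorem IsFlat.of_retract {i : A →ₗ[R] B} {p : B →ₗ[R] A} (hpi : p ∘ₗ i = LinearMap.id)
    (hB : IsFlat R B) : IsFlat R A := by
  intro N N' _ _ _ _ f hf s t hst
  have key : ∀ t : Tensor R N A, lmap R N p (lmap R N i t) = t := fun t => by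
    rw [lmap_lmap, hpi]
    exact DFunLike.congr_fun (tmap_id R) t
  have h := hB N N' f hf (a₁ := lmap R N i s) (a₂ := lmap R N i t)
    (by rw [← lmap_rmap, ← lmap_rmap]; exact congrArg _ hst)
  rw [← key s, h, key]

theorem IsFlat.of_projective [Module.Projective R A] : IsFlat R A := by
  obtain ⟨s, hs⟩ := Module.projective_def'.1 (inferInstance : Module.Projective R A)
  exact (isFlat_finsupp R A).of_retract hs

theorem IsFlat.of_subsingleton [Subsingleton A] : IsFlat R A :=
  (isFlat_finsupp R A).of_retract (i := 0) (p := 0) (Subsingleton.elim _ _)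

variable (S : Type u) [Ring S] (M : Type u) [AddCommGroup M] [Module S M]

/-- The canonical epimorphism of a free module onto `M`. -/
noncomputable abbrev freeCover : (M →₀ S) →ₗ[S] M := Finsupp.linearCombination S id

/-- The first syzygy of `M`: the kernel of `freeCover S M`. -/
noncomputable abbrev syzygy : Submodule S (M →₀ S) := LinearMap.ker (freeCover S M)

theorem isSES_freeCover : IsSES (A := syzygy S M) (B := M →₀ S) (syzygy S M).subtype
    (freeCover S M) :=
  isSES_subtype_ker (Finsupp.linearCombination_id_surjective S M)

end Flat

/-! ### Vanishing of Tor -/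

section Tor

variable (R : Type u) [Ring R]

/-- The vanishing of `Tor_{i+1}^R(N, M)`, expressed by dimension shifting along the canonical free
resolution of the right module `N`: for the first syzygy `N₁` of `N`, `Tor_1(N, M)` is the kernel of
`N₁ ⊗ M → F ⊗ M`, where `F` is free, and `Tor_{i+2}(N, M) = Tor_{i+1}(N₁, M)`. As `N` is resolved
and not `M`, long exact sequences in `M` become diagram chases. -/
def TorZero : ℕ → ∀ (N : Type u) [AddCommGroup N] [Module Rᵐᵒᵖ N]
    (M : Type u) [AddCommGroup M] [Module R M], Prop
  | 0, N, _, _, M, _, _ =>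
    Function.Injective
      (rmap R (N := syzygy Rᵐᵒᵖ N) (N' := N →₀ Rᵐᵒᵖ) (syzygy Rᵐᵒᵖ N).subtype M)
  | i + 1, N, _, _, M, _, _ => TorZero i (syzygy Rᵐᵒᵖ N) M

variable {R} {N N' N'' : Type u} [AddCommGroup N] [Module Rᵐᵒᵖ N]
  [AddCommGroup N'] [Module Rᵐᵒᵖ N'] [AddCommGroup N''] [Module Rᵐᵒᵖ N'']
  {M A B C F : Type u} [AddCommGroup M] [Module R M] [AddCommGroup A] [Module R A]
  [AddCommGroup B] [Module R B] [AddCommGroup C] [Module R C] [AddCommGroup F] [Module R F]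

theorem IsFlat.torZero (hF : IsFlat R F) (i : ℕ) (N : Type u) [AddCommGroup N] [Module Rᵐᵒᵖ N] :
    TorZero R i N F := by
  induction i generalizing N with
  | zero => exact hF _ _ _ Subtype.val_injective
  | succ i ih => exact ih _

theorem IsSES.torZero_zero_iff {f : A →ₗ[R] B} {g : B →ₗ[R] C} (h : IsSES f g)
    (hB : TorZero R 0 N B) :
    TorZero R 0 N C ↔ Function.Injective (lmap R N f) :=
  ⟨fun hC => lmap_injective_of_snake R h (isSES_freeCover Rᵐᵒᵖ N)
    (lmap_injective_finsupp R N h.injective) hC,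
    fun hf => rmap_injective_of_snake R h (isSES_freeCover Rᵐᵒᵖ N) hB hf⟩

/-- Dimension shifting in the left module. -/
theorem IsSES.torZero_succ_iff {f : A →ₗ[R] B} {g : B →ₗ[R] C} (h : IsSES f g) (i : ℕ)
    (hB : TorZero R i N B) (hB' : TorZero R (i + 1) N B) :
    TorZero R (i + 1) N C ↔ TorZero R i N A := by
  induction i generalizing N with
  | succ i ih => exact ih (N := syzygy Rᵐᵒᵖ N) hB hB'
  | zero =>
    have hQ := lmap_injective_finsupp (R := R) N h.injective
    have hcomm := lmap_rmap R (N := syzygy Rᵐᵒᵖ N) (N' := N →₀ Rᵐᵒᵖ) (syzygy Rᵐᵒᵖ N).subtype f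
    refine (h.torZero_zero_iff (N := syzygy Rᵐᵒᵖ N) hB').trans ⟨fun hf => ?_, fun hA => ?_⟩
    · intro s t hst
      refine hf (hB ?_)
      rw [← hcomm, ← hcomm]
      exact congrArg _ hst
    · intro s t hst
      refine hA (hQ ?_)
      rw [hcomm, hcomm, hst]

/-- Dimension shifting in the right module, in the one direction in which `Tor_{i+1}(N, M) = 0` and
`Tor_{i+2}(N'', M) = 0` give `Tor_{i+1}(N', M) = 0`. -/
theorem IsSES.torZero_of_right {f : N' →ₗ[Rᵐᵒᵖ] N} {g : N →ₗ[Rᵐᵒᵖ] N''} (h : IsSES f g) (i : ℕ)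
    (hN : TorZero R i N M) (hN'' : TorZero R (i + 1) N'' M) : TorZero R i N' M := by
  have hP : ∀ (M : Type u) [AddCommGroup M] [Module R M], IsFlat R (M →₀ R) :=
    fun M _ _ => isFlat_finsupp R M
  induction i generalizing M with
  | succ i ih =>
    have shift : ∀ (X : Type u) [AddCommGroup X] [Module Rᵐᵒᵖ X] (j : ℕ), _ := fun X _ _ j =>
      (isSES_freeCover R M).torZero_succ_iff (N := X) j ((hP M).torZero _ _) ((hP M).torZero _ _)
    exact (shift N' i).2 (ih ((shift N i).1 hN) ((shift N'' (i + 1)).1 hN''))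
  | zero =>
    have hM := isSES_freeCover R M
    have hK := isSES_freeCover R (syzygy R M)
    rw [hM.torZero_zero_iff ((hP M).torZero _ _)] at hN ⊢
    rw [zero_add, hM.torZero_succ_iff 0 ((hP M).torZero _ _) ((hP M).torZero _ _),
      hK.torZero_zero_iff ((hP _).torZero _ _)] at hN''
    have hf : Function.Injective (rmap R f (syzygy R M)) :=
      rmap_injective_of_snake R hK h (hP _ _ _ f h.injective) hN''
    intro s t hst
    refine hf (hN ?_)
    rw [lmap_rmap, lmap_rmap, hst]

/-- `TorZero` computed from an arbitrary flat resolution of the left module. -/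
theorem torZero_iff_of_resolution {P : ℕ → ModuleCat.{u} R} (d : ∀ i, P (i + 1) →ₗ[R] P i)
    (π : P 0 →ₗ[R] M) (hP : ∀ i, IsFlat R (P i)) (hπ : Function.Surjective π)
    (h0 : Function.Exact (d 0) π) (hd : ∀ i, Function.Exact (d (i + 1)) (d i)) (i : ℕ) :
    TorZero R i N M ↔ Function.Exact (lmap R N (d (i + 1))) (lmap R N (d i)) := by
  have hses : ∀ i, IsSES (LinearMap.range (d (i + 1))).subtype (d i).rangeRestrict := fun i =>
    ⟨Subtype.val_injective, fun x => by
      rw [← (LinearMap.exact_iff.1 (hd i))]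
      simp [Subtype.ext_iff], (d i).surjective_rangeRestrict⟩
  have hses0 : IsSES (LinearMap.range (d 0)).subtype π :=
    ⟨Subtype.val_injective, fun x => by
      rw [h0 x]
      simp, hπ⟩
  have key : ∀ i, TorZero R i N M ↔
      Function.Injective (lmap R N (LinearMap.range (d i)).subtype) := by
    intro i
    cases i with
    | zero => exact hses0.torZero_zero_iff ((hP 0).torZero _ _)
    | succ i =>
      rw [← (hses i).torZero_zero_iff ((hP _).torZero _ _),
        hses0.torZero_succ_iff i ((hP _).torZero _ _) ((hP _).torZero _ _)]
      suffices ∀ j k, TorZero R (j + k) N (LinearMap.range (d 0)) ↔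
          TorZero R j N (LinearMap.range (d k)) by simpa using this 0 i
      intro j k
      induction k generalizing j with
      | zero => rfl
      | succ k ih =>
        rw [← (hses k).torZero_succ_iff j ((hP _).torZero _ _) ((hP _).torZero _ _), ← ih,
          add_right_comm, add_assoc]
  have hfac : ∀ t, lmap R N (d i) t = lmap R N (LinearMap.range (d i)).subtype
      (lmap R N (d i).rangeRestrict t) := fun t => by
    rw [lmap_lmap]; rfl
  have hex : Function.Exact (lmap R N (d (i + 1))) (lmap R N (d i).rangeRestrict) := by
    refine lmap_exact R (fun x => ?_) (d i).surjective_rangeRestrict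
    rw [← hd i x]
    simp [Subtype.ext_iff]
  have hsurj : Function.Surjective (lmap R N (d i).rangeRestrict) :=
    tmap_surjective R Function.surjective_id (d i).surjective_rangeRestrict
  rw [key]
  constructor
  · intro h t
    rw [← hex t, hfac, map_eq_zero_iff _ h]
  · intro h
    refine (injective_iff_map_eq_zero _).2 fun x hx => ?_
    obtain ⟨t, rfl⟩ := hsurj x
    rw [← hfac] at hx
    exact (hex t).2 ((h t).1 hx)

theorem isZero_tor_succ_iff (i : ℕ) (N : Type u) [AddCommGroup N] [Module Rᵐᵒᵖ N]
    (M : Type u) [AddCommGroup M] [Module R M] :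
    Limits.IsZero (Tor R N (i + 1) M) ↔ TorZero R i N M := by
  let P := projectiveResolution (ModuleCat.of R M)
  let T := tensorFunctor R N
  have hflat : ∀ i, IsFlat R (P.complex.X i) := fun i => by
    have : Module.Projective R (P.complex.X i) :=
      (IsProjective.iff_projective _).2 (P.projective i)
    exact IsFlat.of_projective
  have h1 : Limits.IsZero (Tor R N (i + 1) M) ↔
      ((T.mapHomologicalComplex _).obj P.complex).ExactAt (i + 1) := by
    rw [HomologicalComplex.exactAt_iff_isZero_homology]
    exact (P.isoLeftDerivedObj T (i + 1)).isZero_iff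
  let π : P.complex.X 0 →ₗ[R] M := (P.π.f 0).hom
  have h2 := torZero_iff_of_resolution (N := N) (P := fun i => P.complex.X i)
    (fun i => (P.complex.d (i + 1) i).hom) π hflat
    ((ModuleCat.epi_iff_surjective (P.π.f 0)).1 inferInstance)
    ((ShortComplex.ShortExact.moduleCat_exact_iff_function_exact _).1 P.exact₀)
    (fun i => (ShortComplex.ShortExact.moduleCat_exact_iff_function_exact _).1 (P.exact_succ i)) i
  rw [h1, h2, HomologicalComplex.exactAt_iff' _ (i + 2) (i + 1) i (by simp) (by simp),
    ShortComplex.ab_exact_iff_function_exact]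
  rfl

end Tor

/-! ### Right modules of finite injective dimension -/

section Injective

variable {R : Type u} [Ring R] {M : Type u} [AddCommGroup M] [Module R M]

/-- Embedding a module of injective dimension at most `n + 1` in an injective module lowers the
injective dimension. -/
theorem exists_isSES_injective {S : Type u} [Ring S] (E : ModuleCat.{u} S) (n : ℕ)
    [HasInjectiveDimensionLT E (n + 2)] :
    ∃ (I E' : ModuleCat.{u} S) (f : E →ₗ[S] I) (g : I →ₗ[S] E'), IsSES f g ∧
      Module.Injective S I ∧ HasInjectiveDimensionLT E' (n + 1) := by
  let T := ShortComplex.mk (Injective.ι E) (Limits.cokernel.π _) (Limits.cokernel.condition _)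
  have hT : T.ShortExact :=
    { exact := ShortComplex.exact_cokernel _
      mono_f := inferInstanceAs (Mono (Injective.ι E))
      epi_g := inferInstanceAs (Epi (Limits.cokernel.π _)) }
  refine ⟨T.X₂, T.X₃, T.f.hom, T.g.hom, ⟨hT.moduleCat_injective_f,
    (ShortComplex.ShortExact.moduleCat_exact_iff_function_exact _).1 hT.exact,
    hT.moduleCat_surjective_g⟩, (Module.injective_iff_injective_object S _).2
      (inferInstanceAs (Injective (Injective.under E))),
    (hT.hasInjectiveDimensionLT_X₃_iff n (inferInstanceAs (Injective (Injective.under E)))).2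
      inferInstance⟩

theorem injectiveDimension_lt_top {S : Type u} [Ring S] (I : ModuleCat.{u} S)
    (hI : Module.Injective S I) : injectiveDimension I < ⊤ := by
  have : Injective I := (Module.injective_iff_injective_object S I).1 hI
  exact lt_top_iff_ne_top.2 ((injectiveDimension_ne_top_iff I).2
    ⟨0, injective_iff_hasInjectiveDimensionLT_one.1 this⟩)

theorem torZero_of_injectiveDimension_lt_top {n : ℕ}
    (h : ∀ i, n ≤ i → ∀ I : ModuleCat.{u} Rᵐᵒᵖ, Module.Injective Rᵐᵒᵖ I → TorZero R i I M)
    {i : ℕ} (hi : n ≤ i) (E : ModuleCat.{u} Rᵐᵒᵖ) (hE : injectiveDimension E < ⊤) :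
    TorZero R i E M := by
  obtain ⟨k, hk⟩ := (injectiveDimension_ne_top_iff E).1 hE.ne
  clear hE
  induction k generalizing i E with
  | zero =>
    exact h i hi E ((Module.injective_iff_injective_object _ _).2
      (injective_iff_hasInjectiveDimensionLT_one.2 hk))
  | succ k ih =>
    obtain ⟨I, E', f, g, hfg, hI, hE'⟩ := exists_isSES_injective E k
    exact hfg.torZero_of_right i (h i hi I hI) (ih (by omega) E' hE')

end Injective

/-! ### Gorenstein flat modules -/

section GorensteinFlat

variable {R : Type u} [Ring R]

/-- `GFStep R A C`: there is an exact sequence `0 → A → F → C → 0` with `F` flat such that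
`I ⊗ A → I ⊗ F` is injective for all injective right modules `I`. A totally acyclic complex of flat
modules is a `ℤ`-indexed chain of such steps between its syzygies. -/
def GFStep (R : Type u) [Ring R] (A C : ModuleCat.{u} R) : Prop :=
  ∃ (F : ModuleCat.{u} R) (f : A →ₗ[R] F) (g : F →ₗ[R] C), IsFlat R F ∧ IsSES f g ∧
    ∀ I : ModuleCat.{u} Rᵐᵒᵖ, Module.Injective Rᵐᵒᵖ I → Function.Injective (lmap R I f)

variable {M A B C F G K L P : Type u} [AddCommGroup M] [Module R M] [AddCommGroup A] [Module R A]
  [AddCommGroup B] [Module R B] [AddCommGroup C] [Module R C] [AddCommGroup F] [Module R F]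
  [AddCommGroup G] [Module R G] [AddCommGroup K] [Module R K] [AddCommGroup L] [Module R L]
  [AddCommGroup P] [Module R P]

theorem isGorensteinFlat_of_steps {Z : ℤ → ModuleCat.{u} R}
    (hZ : ∀ i, GFStep R (Z i) (Z (i + 1))) (e : M ≃ₗ[R] Z 0) : IsGorensteinFlat R M := by
  choose F f g hF hfg hI using hZ
  refine ⟨F, fun i => f (i + 1) ∘ₗ g i, hF, fun i x => ?_, fun I _ _ hInj i x => ?_,
    ⟨e.trans (LinearEquiv.ofInjective (f 0) (hfg 0).injective) |>.trans
      (LinearEquiv.ofEq _ _ ?_)⟩⟩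
  · rw [LinearMap.comp_apply, map_eq_zero_iff _ (hfg _).injective, (hfg _).exact]
    simp only [LinearMap.coe_comp, (hfg i).surjective.range_comp]
  · rw [← lmap_lmap, map_eq_zero_iff _ (hI (i + 1 + 1) (ModuleCat.of _ I) hInj),
      lmap_exact R (hfg (i + 1)).exact (hfg (i + 1)).surjective x]
    have hs : Function.Surjective (lmap R I (g i)) :=
      tmap_surjective R Function.surjective_id (hfg i).surjective
    constructor
    · rintro ⟨y, rfl⟩
      obtain ⟨z, rfl⟩ := hs y
      exact ⟨z, (lmap_lmap R _ _ z).symm⟩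
    · rintro ⟨z, rfl⟩
      exact ⟨_, lmap_lmap R (g i) (f (i + 1)) z⟩
  · exact (LinearMap.range_comp_of_range_eq_top (f (-1 + 1))
      (LinearMap.range_eq_top.2 (hfg (-1)).surjective)).symm

theorem lmap_injective_of_comp {I : Type u} [AddCommGroup I] [Module Rᵐᵒᵖ I] {a : A →ₗ[R] B}
    {b : B →ₗ[R] K} {i : K →ₗ[R] C} (hab : Function.Exact a b) (hb : Function.Surjective b)
    (hI : Function.Exact (lmap R I a) (lmap R I (i ∘ₗ b))) : Function.Injective (lmap R I i) := by
  refine (injective_iff_map_eq_zero _).2 fun x hx => ?_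
  obtain ⟨y, rfl⟩ := tmap_surjective R (f := (LinearMap.id : I →ₗ[Rᵐᵒᵖ] I))
    Function.surjective_id hb x
  refine (lmap_exact R hab hb y).2 ((hI y).1 ?_)
  rw [← hx, lmap_lmap]

theorem IsGorensteinFlat.exists_steps (h : IsGorensteinFlat R M) :
    ∃ Z : ℤ → ModuleCat.{u} R, (∀ i, GFStep R (Z i) (Z (i + 1))) ∧ Nonempty (M ≃ₗ[R] Z 0) := by
  obtain ⟨F, d, hF, hd, hI, ⟨e⟩⟩ := h
  refine ⟨fun i => ModuleCat.of R (LinearMap.ker (d i)), fun i => ?_, ⟨e.trans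
    (LinearEquiv.ofEq _ (LinearMap.ker (d 0)) (LinearMap.exact_iff.1 (hd (-1))).symm)⟩⟩
  have hs : ∀ i, Function.Surjective ((d i).codRestrict (LinearMap.ker (d (i + 1)))
      fun x => (hd i _).2 ⟨x, rfl⟩) := fun i y => by
    obtain ⟨x, hx⟩ := (hd i y).1 y.2
    exact ⟨x, Subtype.ext hx⟩
  refine ⟨F i, (LinearMap.ker (d i)).subtype, (d i).codRestrict (LinearMap.ker (d (i + 1)))
    fun x => (hd i _).2 ⟨x, rfl⟩, hF i, ⟨Subtype.val_injective, fun x => ?_, hs i⟩,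
    fun I hInj => ?_⟩
  · constructor
    · intro h
      exact ⟨⟨x, congrArg Subtype.val h⟩, rfl⟩
    · rintro ⟨y, rfl⟩
      exact Subtype.ext y.2
  · obtain ⟨j, rfl⟩ : ∃ j, i = j + 1 + 1 := ⟨i - 1 - 1, by ring⟩
    refine lmap_injective_of_comp (a := d j) (b := (d (j + 1)).codRestrict
      (LinearMap.ker (d (j + 1 + 1))) fun x => (hd (j + 1) _).2 ⟨x, rfl⟩) (fun x => ?_)
      (hs (j + 1)) (hI I hInj j)
    rw [← hd j x]
    exact Subtype.ext_iff

theorem IsGorensteinFlat.of_equiv (e : M ≃ₗ[R] A) (h : IsGorensteinFlat R M) :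
    IsGorensteinFlat R A := by
  obtain ⟨Z, hZ, ⟨e'⟩⟩ := h.exists_steps
  exact isGorensteinFlat_of_steps hZ (e.symm.trans e')

/-- A relation that can be followed forwards and backwards inside `p` has `ℤ`-indexed chains
through each point of `p`. -/
theorem exists_int_chain {α : Type*} {r : α → α → Prop} {p : α → Prop}
    (next : ∀ x, p x → ∃ y, p y ∧ r x y) (prev : ∀ x, p x → ∃ y, p y ∧ r y x) (x : α) (hx : p x) :
    ∃ z : ℤ → α, z 0 = x ∧ ∀ i, r (z i) (z (i + 1)) := by
  choose! a ha har using next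
  choose! b hb hbr using prev
  have hpa : ∀ n, p (a^[n] x) := fun n => by
    induction n with
    | zero => exact hx
    | succ n ih => rw [Function.iterate_succ_apply']; exact ha _ ih
  have hpb : ∀ n, p (b^[n] x) := fun n => by
    induction n with
    | zero => exact hx
    | succ n ih => rw [Function.iterate_succ_apply']; exact hb _ ih
  let z : ℤ → α := fun
    | .ofNat n => a^[n] x
    | .negSucc n => b^[n + 1] x
  refine ⟨z, rfl, fun i => ?_⟩
  match i with
  | .ofNat n =>
    change r (a^[n] x) (a^[n + 1] x)
    rw [Function.iterate_succ_apply']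
    exact har _ (hpa n)
  | .negSucc n =>
    have : z (Int.negSucc n + 1) = b^[n] x := by
      cases n with
      | zero => rfl
      | succ n => rfl
    rw [this]
    change r (b^[n + 1] x) _
    rw [Function.iterate_succ_apply']
    exact hbr _ (hpb n)

/-- The class of Gorenstein flat modules is the largest class in which `GFStep` can be followed
forwards and backwards. -/
theorem isGorensteinFlat_of_class {p : ModuleCat.{u} R → Prop}
    (next : ∀ A, p A → ∃ C, p C ∧ GFStep R A C) (prev : ∀ A, p A → ∃ C, p C ∧ GFStep R C A)
    (hM : p (ModuleCat.of R M)) : IsGorensteinFlat R M := by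
  obtain ⟨Z, h0, hZ⟩ := exists_int_chain next prev _ hM
  refine isGorensteinFlat_of_steps hZ ?_
  rw [h0]

theorem IsSES.bot_left (e : M ≃ₗ[R] A) : IsSES (0 : PUnit.{u + 1} →ₗ[R] M) e.toLinearMap :=
  ⟨fun _ _ _ => rfl, fun x => by simpa using eq_comm, e.surjective⟩

theorem IsSES.bot_right (e : M ≃ₗ[R] A) : IsSES e.toLinearMap (0 : A →ₗ[R] PUnit.{u + 1}) :=
  ⟨e.injective, fun x => by simp, fun _ => ⟨0, rfl⟩⟩

theorem IsFlat.isGorensteinFlat (hM : IsFlat R M) : IsGorensteinFlat R M := by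
  have hz : IsFlat R PUnit.{u + 1} := IsFlat.of_subsingleton
  refine isGorensteinFlat_of_class (p := fun A => IsFlat R A)
    (fun A hA => ⟨ModuleCat.of R PUnit, hz, A, _, _, hA, .bot_right (.refl R A), fun I _ => ?_⟩)
    (fun A hA => ⟨ModuleCat.of R PUnit, hz, A, _, _, hA, .bot_left (.refl R A), fun I _ => ?_⟩) hM
  · exact ((IsSES.bot_right (.refl R A)).torZero_zero_iff (hA.torZero 0 I)).1 (hz.torZero 0 I)
  · exact ((IsSES.bot_left (.refl R A)).torZero_zero_iff (hA.torZero 0 I)).1 (hA.torZero 0 I)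

theorem IsGorensteinFlat.of_subsingleton [Subsingleton M] : IsGorensteinFlat R M :=
  IsFlat.of_subsingleton.isGorensteinFlat

theorem IsGorensteinFlat.torZero (hM : IsGorensteinFlat R M) (i : ℕ) (I : ModuleCat.{u} Rᵐᵒᵖ)
    (hI : Module.Injective Rᵐᵒᵖ I) : TorZero R i I M := by
  obtain ⟨Z, hZ, ⟨e⟩⟩ := hM.exists_steps
  have key : ∀ (i : ℕ) (j : ℤ), TorZero R i I (Z j) := by
    intro i
    induction i with
    | zero =>
      intro j
      obtain ⟨j, rfl⟩ : ∃ k, j = k + 1 := ⟨j - 1, by ring⟩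
      obtain ⟨F, f, g, hF, hfg, h⟩ := hZ j
      exact (hfg.torZero_zero_iff (hF.torZero _ _)).2 (h I hI)
    | succ i ih =>
      intro j
      obtain ⟨j, rfl⟩ : ∃ k, j = k + 1 := ⟨j - 1, by ring⟩
      obtain ⟨F, f, g, hF, hfg, h⟩ := hZ j
      exact (hfg.torZero_succ_iff i (hF.torZero _ _) (hF.torZero _ _)).2 (ih j)
  -- dimension shifting in `0 → M → Z 0 → 0 → 0` transports the vanishing along `e`
  exact ((IsSES.bot_right e).torZero_succ_iff i (key i 0) (key (i + 1) 0)).1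
    (IsFlat.of_subsingleton.torZero _ _)

theorem IsGorensteinFlat.exists_isSES_left (hM : IsGorensteinFlat R M) :
    ∃ (F G : ModuleCat.{u} R) (f : M →ₗ[R] F) (g : F →ₗ[R] G), IsFlat R F ∧
      IsGorensteinFlat R G ∧ IsSES f g := by
  obtain ⟨Z, hZ, ⟨e⟩⟩ := hM.exists_steps
  obtain ⟨F, f, g, hF, hfg, -⟩ := hZ 0
  refine ⟨F, Z (0 + 1), f ∘ₗ e.toLinearMap, g, hF,
    isGorensteinFlat_of_steps (Z := fun i => Z (i + 1)) (fun i => hZ (i + 1)) (.refl R _),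
    hfg.injective.comp e.injective, fun x => ?_, hfg.surjective⟩
  rw [hfg.exact x, LinearMap.coe_comp, LinearEquiv.coe_coe, e.surjective.range_comp]

theorem IsGorensteinFlat.exists_isSES_right (hM : IsGorensteinFlat R M) :
    ∃ (G F : ModuleCat.{u} R) (f : G →ₗ[R] F) (g : F →ₗ[R] M), IsFlat R F ∧
      IsGorensteinFlat R G ∧ IsSES f g := by
  obtain ⟨Z, hZ, ⟨e⟩⟩ := hM.exists_steps
  have h0 : GFStep R (Z (-1)) (Z 0) := hZ (-1)
  obtain ⟨F, f, g, hF, hfg, -⟩ := h0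
  refine ⟨Z (-1), F, f, e.symm.toLinearMap ∘ₗ g, hF,
    isGorensteinFlat_of_steps (Z := fun i => Z (i - 1)) (fun i => ?_) (.refl R _),
    hfg.injective, fun x => ?_, e.symm.surjective.comp hfg.surjective⟩
  · rw [show i + 1 - 1 = i - 1 + 1 by ring]
    exact hZ (i - 1)
  · rw [← hfg.exact x]
    exact e.symm.map_eq_zero_iff

/-- A submodule of a flat module with Gorenstein flat quotient is Gorenstein flat: the steps of the
quotient continue `0 → M → F → G → 0` to the right, and since Tor of `M` against injectives
vanishes, a free resolution of `M` provides the other half of the complex. -/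
theorem IsSES.isGorensteinFlat_left {f : M →ₗ[R] F} {g : F →ₗ[R] G} (h : IsSES f g)
    (hF : IsFlat R F) (hG : IsGorensteinFlat R G) : IsGorensteinFlat R M := by
  have hGT := hG.torZero
  obtain ⟨Z, hZ, ⟨e⟩⟩ := hG.exists_steps
  -- Modules with vanishing Tor from which the steps can be followed forwards indefinitely.
  let p : ModuleCat.{u} R → Prop := fun A =>
    (∀ i, ∀ I : ModuleCat.{u} Rᵐᵒᵖ, Module.Injective Rᵐᵒᵖ I → TorZero R i I A) ∧
      ∃ Y : ℕ → ModuleCat.{u} R, Y 0 = A ∧ ∀ n, GFStep R (Y n) (Y (n + 1))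
  refine isGorensteinFlat_of_class (p := p) ?_ ?_ ⟨fun i I hI =>
    (h.torZero_succ_iff i (hF.torZero _ _) (hF.torZero _ _)).1 (hGT (i + 1) I hI),
    fun n => Nat.casesOn n (ModuleCat.of R M) fun n => Z n, rfl, fun n => ?_⟩
  · rintro _ ⟨hA, Y, rfl, hY⟩
    refine ⟨Y 1, ⟨fun i I hI => ?_, fun n => Y (n + 1), rfl, fun n => hY (n + 1)⟩, hY 0⟩
    obtain ⟨F', f', g', hF', hfg', hI'⟩ := hY 0
    cases i with
    | zero => exact (hfg'.torZero_zero_iff (hF'.torZero _ _)).2 (hI' I hI)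
    | succ i => exact (hfg'.torZero_succ_iff i (hF'.torZero _ _) (hF'.torZero _ _)).2 (hA i I hI)
  · rintro _ ⟨hA, Y, rfl, hY⟩
    have hP : IsFlat R (Y 0 →₀ R) := isFlat_finsupp R _
    have hses := isSES_freeCover R (Y 0)
    have step : GFStep R (ModuleCat.of R (syzygy R (Y 0))) (Y 0) :=
      ⟨ModuleCat.of R (Y 0 →₀ R), _, _, hP, hses, fun I hI =>
        (hses.torZero_zero_iff (hP.torZero _ _)).1 (hA 0 I hI)⟩
    refine ⟨ModuleCat.of R (syzygy R (Y 0)), ⟨fun i I hI =>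
      (hses.torZero_succ_iff i (hP.torZero _ _) (hP.torZero _ _)).1 (hA (i + 1) I hI),
      fun n => Nat.casesOn n (ModuleCat.of R (syzygy R (Y 0))) Y, rfl, fun n => ?_⟩, step⟩
    cases n with
    | zero => exact step
    | succ n => exact hY n
  · cases n with
    | zero =>
      refine ⟨ModuleCat.of R F, f, e.toLinearMap ∘ₗ g, hF, ⟨h.injective, fun x => ?_,
        e.surjective.comp h.surjective⟩, fun I hI =>
          (h.torZero_zero_iff (hF.torZero _ _)).1 (hGT 0 I hI)⟩
      rw [← h.exact x]
      exact e.map_eq_zero_iff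
    | succ n => exact hZ n

/-! ### Consequences of closure under extensions -/

theorem IsSES.isGorensteinFlat_middle (hR : IsLeftGFClosed R) {f : A →ₗ[R] B} {g : B →ₗ[R] C}
    (h : IsSES f g) (hA : IsGorensteinFlat R A) (hC : IsGorensteinFlat R C) :
    IsGorensteinFlat R B :=
  hR A B C f g h.injective h.exact h.surjective hA hC

/-- Over a GF-closed ring the Gorenstein flat modules are closed under kernels of epimorphisms. -/
theorem IsSES.isGorensteinFlat_ker (hR : IsLeftGFClosed R) {f : A →ₗ[R] B} {g : B →ₗ[R] C}
    (h : IsSES f g) (hB : IsGorensteinFlat R B) (hC : IsGorensteinFlat R C) :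
    IsGorensteinFlat R A := by
  obtain ⟨G', F, k, h', hF, hG', hk⟩ := hC.exists_isSES_right
  obtain ⟨D, a, b, c, e, hab, hce⟩ := h.exists_pullback hk
  obtain ⟨F', G, m, q, hF', hG, hmq⟩ :=
    (hce.isGorensteinFlat_middle hR hG' hB).exists_isSES_left
  -- `A ⊆ D ⊆ F'` with `D / A = F` and `F' / D = G`, so `F' / A` is Gorenstein flat
  obtain ⟨E, p, i, r, hp, hir⟩ := hab.exists_quotient hmq
  exact hp.isGorensteinFlat_left hF' (hir.isGorensteinFlat_middle hR hF.isGorensteinFlat hG)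

theorem exists_injective_embedding {S : Type u} [Ring S] (X : ModuleCat.{u} S) :
    ∃ (I : ModuleCat.{u} S) (ι : X →ₗ[S] I), Module.Injective S I ∧ Function.Injective ι :=
  ⟨Injective.under X, (Injective.ι X).hom, (Module.injective_iff_injective_object _ _).2
    (inferInstanceAs (Injective (Injective.under X))),
    (ModuleCat.mono_iff_injective (Injective.ι X)).1 inferInstance⟩

/-- The cokernel of a monomorphism between flat modules is flat as soon as the monomorphism
survives tensoring with injectives: every right module embeds in an injective one. -/
theorem IsSES.isFlat_right {f : A →ₗ[R] B} {g : B →ₗ[R] C} (h : IsSES f g) (hA : IsFlat R A)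
    (hB : IsFlat R B) (hI : ∀ I : ModuleCat.{u} Rᵐᵒᵖ, Module.Injective Rᵐᵒᵖ I →
      Function.Injective (lmap R I f)) : IsFlat R C := by
  intro N N' _ _ _ _ k hk
  refine rmap_injective_of_snake R h (isSES_mkQ_range hk) (hB _ _ k hk) ?_
  obtain ⟨I, ι, hinj, hι⟩ :=
    exists_injective_embedding (ModuleCat.of Rᵐᵒᵖ (N' ⧸ LinearMap.range k))
  intro s t hst
  refine hA _ _ ι hι (hI I hinj ?_)
  rw [lmap_rmap, lmap_rmap]
  exact congrArg (rmap R ι B) hst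

/-- If `A` and `B` are Gorenstein flat and `Tor_1(I, C) = 0` for all injectives `I`, then the
quotient `C` of `B` by `A` is Gorenstein flat. -/
theorem IsSES.isGorensteinFlat_right (hR : IsLeftGFClosed R) {f : A →ₗ[R] B} {g : B →ₗ[R] C}
    (h : IsSES f g) (hA : IsGorensteinFlat R A) (hB : IsGorensteinFlat R B)
    (hI : ∀ I : ModuleCat.{u} Rᵐᵒᵖ, Module.Injective Rᵐᵒᵖ I → TorZero R 0 I C) :
    IsGorensteinFlat R C := by
  obtain ⟨F, G, k, l, hF, hG, hkl⟩ := hA.exists_isSES_left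
  obtain ⟨D, a, b, c, e, hab, hce⟩ := h.exists_pushout hkl
  have hD := hab.isGorensteinFlat_middle hR hB hG
  obtain ⟨F', G', m, q, hF', hG', hmq⟩ := hD.exists_isSES_left
  -- `F ⊆ D ⊆ F'` with `D / F = C`, so `C` embeds in `H = F' / F`, which turns out to be flat
  obtain ⟨H, p, i, r, hp, hir⟩ := hce.exists_quotient hmq
  refine hir.isGorensteinFlat_left (hp.isFlat_right hF hF' fun I hInj => ?_) hG'
  have hc : Function.Injective (lmap R I c) :=
    (hce.torZero_zero_iff (hD.torZero 0 I hInj)).1 (hI I hInj)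
  have hm : Function.Injective (lmap R I m) :=
    (hmq.torZero_zero_iff (hF'.torZero 0 I)).1 (hG'.torZero 0 I hInj)
  intro s t hst
  refine hc (hm ?_)
  rw [lmap_lmap, lmap_lmap, hst]

end GorensteinFlat

/-! ### Gorenstein flat resolutions -/

section Resolution

variable {R : Type u} [Ring R] {M A B C F G K L P : Type u} [AddCommGroup M] [Module R M]
  [AddCommGroup A] [Module R A]
  [AddCommGroup B] [Module R B] [AddCommGroup C] [Module R C] [AddCommGroup F] [Module R F]
  [AddCommGroup G] [Module R G] [AddCommGroup K] [Module R K] [AddCommGroup L] [Module R L]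
  [AddCommGroup P] [Module R P]

/-- The sequence `0 → M → M → 0`. -/
def ExactSeq.self (R : Type u) [Ring R] (M : Type u) [AddCommGroup M] [Module R M] (n : ℕ) :
    ExactSeq R M n where
  G i := Nat.casesOn i (ModuleCat.of R M) fun _ => ModuleCat.of R PUnit
  d _ := 0
  aug := LinearMap.id
  aug_surjective := Function.surjective_id
  exact_zero x := by simp [eq_comm]
  exact_succ _ x := ⟨fun _ => ⟨0, rfl⟩, fun _ => rfl⟩
  subsingleton_of_gt i hi := by
    cases i with
    | zero => omega
    | succ i => exact inferInstanceAs (Subsingleton PUnit)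

/-- Splicing `0 → K → G → M → 0` with an exact sequence ending in `K`. -/
def ExactSeq.cons {k : K →ₗ[R] G} {g : G →ₗ[R] M} (h : IsSES k g) {n : ℕ} (S : ExactSeq R K n) :
    ExactSeq R M (n + 1) where
  G i := Nat.casesOn i (ModuleCat.of R G) S.G
  d i := match i with
    | 0 => k ∘ₗ S.aug
    | i + 1 => S.d i
  aug := g
  aug_surjective := h.surjective
  exact_zero x := by
    rw [h.exact x, ← S.aug_surjective.range_comp]
    rfl
  exact_succ i := by
    cases i with
    | zero =>
      intro x
      rw [← S.exact_zero x]
      exact map_eq_zero_iff _ h.injective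
    | succ i => exact S.exact_succ i
  subsingleton_of_gt i hi := by
    cases i with
    | zero => omega
    | succ i => exact S.subsingleton_of_gt i (by omega)

/-- The part of an exact sequence ending in the kernel of its last map. -/
def ExactSeq.tail {n : ℕ} (S : ExactSeq R M (n + 1)) : ExactSeq R (LinearMap.ker S.aug) n where
  G i := S.G (i + 1)
  d i := S.d (i + 1)
  aug := (S.d 0).codRestrict _ fun x => (S.exact_zero _).2 ⟨x, rfl⟩
  aug_surjective y := by
    obtain ⟨x, hx⟩ := (S.exact_zero y).1 y.2
    exact ⟨x, Subtype.ext hx⟩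
  exact_zero x := by
    rw [← S.exact_succ 0 x]
    exact Subtype.ext_iff
  exact_succ i := S.exact_succ (i + 1)
  subsingleton_of_gt i hi := S.subsingleton_of_gt (i + 1) (by omega)

/-- The map `G 0 → M` of a sequence of length `0` is an isomorphism. -/
noncomputable def ExactSeq.equiv (S : ExactSeq R M 0) : S.G 0 ≃ₗ[R] M :=
  LinearEquiv.ofBijective S.aug ⟨(injective_iff_map_eq_zero _).2 fun x hx => by
    obtain ⟨y, rfl⟩ := (S.exact_zero x).1 hx
    have := S.subsingleton_of_gt 1 one_pos
    rw [Subsingleton.elim y 0, map_zero], S.aug_surjective⟩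

theorem hasGFResolution_zero_iff : HasGFResolution R M 0 ↔ IsGorensteinFlat R M := by
  constructor
  · rintro ⟨S, hS⟩
    exact (hS 0 le_rfl).of_equiv S.equiv
  · intro h
    refine ⟨.self R M 0, fun i hi => ?_⟩
    obtain rfl : i = 0 := by omega
    exact h

theorem IsSES.hasGFResolution_succ {k : K →ₗ[R] G} {g : G →ₗ[R] M} (h : IsSES k g)
    (hG : IsGorensteinFlat R G) {n : ℕ} (hK : HasGFResolution R K n) :
    HasGFResolution R M (n + 1) := by
  obtain ⟨S, hS⟩ := hK
  refine ⟨S.cons h, fun i hi => ?_⟩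
  cases i with
  | zero => exact hG
  | succ i => exact hS i (by omega)

theorem HasGFResolution.exists_isSES {n : ℕ} (h : HasGFResolution R M (n + 1)) :
    ∃ (K G : ModuleCat.{u} R) (k : K →ₗ[R] G) (g : G →ₗ[R] M), IsSES k g ∧
      IsGorensteinFlat R G ∧ HasGFResolution R K n := by
  obtain ⟨S, hS⟩ := h
  exact ⟨ModuleCat.of R (LinearMap.ker S.aug), S.G 0, _, _, isSES_subtype_ker S.aug_surjective,
    hS 0 (by omega), S.tail, fun i hi => hS (i + 1) (by omega)⟩

theorem HasGFResolution.mono {m n : ℕ} (hmn : m ≤ n) (h : HasGFResolution R M m) :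
    HasGFResolution R M n := by
  obtain ⟨S, hS⟩ := h
  refine ⟨⟨S.G, S.d, S.aug, S.aug_surjective, S.exact_zero, S.exact_succ,
    fun i hi => S.subsingleton_of_gt i (by omega)⟩, fun i _ => ?_⟩
  obtain hi | hi := le_or_gt i m
  · exact hS i hi
  · have := S.subsingleton_of_gt i hi
    exact .of_subsingleton

theorem gfd_le_iff {n : ℕ} : gfd R M ≤ n ↔ HasGFResolution R M n := by
  constructor
  · intro h
    by_contra hn
    have hlt : ((n + 1 : ℕ) : ℕ∞) ≤ gfd R M := le_iInf₂ fun m hm => by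
      have : n < m := by
        by_contra hmn
        exact hn (hm.mono (by omega))
      exact_mod_cast this
    have := hlt.trans h
    norm_cast at this
    omega
  · exact fun h => iInf₂_le n h

theorem gfd_lt_top_iff : gfd R M < ⊤ ↔ ∃ n, HasGFResolution R M n := by
  constructor
  · intro h
    obtain ⟨n, hn⟩ := ENat.ne_top_iff_exists.1 h.ne
    exact ⟨n, gfd_le_iff.1 hn.ge⟩
  · rintro ⟨n, hn⟩
    exact (gfd_le_iff.2 hn).trans_lt (ENat.natCast_lt_top n)

/-! ### Gorenstein flat dimension over GF-closed rings -/

/-- Extending a Gorenstein flat module by a module of Gorenstein flat dimension at most `n`. -/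
theorem IsSES.hasGFResolution_middle (hR : IsLeftGFClosed R) {f : L →ₗ[R] P} {g : P →ₗ[R] G}
    (h : IsSES f g) {n : ℕ} (hL : HasGFResolution R L n) (hG : IsGorensteinFlat R G) :
    HasGFResolution R P n := by
  induction n generalizing L P G with
  | zero =>
    rw [hasGFResolution_zero_iff] at hL ⊢
    exact h.isGorensteinFlat_middle hR hL hG
  | succ n ih =>
    obtain ⟨L', G', i, p, hip, hG', hL'⟩ := hL.exists_isSES
    have hq := isSES_freeCover R G
    have hQ : IsGorensteinFlat R (G →₀ R) := (isFlat_finsupp R G).isGorensteinFlat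
    obtain ⟨X, a, b, c, e, hab, hce⟩ := h.exists_horseshoe hip hq
    have hprod : IsSES (LinearMap.inl R G' (G →₀ R)) (LinearMap.snd R G' (G →₀ R)) :=
      ⟨LinearMap.inl_injective, .inl_snd, LinearMap.snd_surjective⟩
    exact hab.hasGFResolution_succ (hprod.isGorensteinFlat_middle hR hG' hQ)
      (ih hce hL' (hq.isGorensteinFlat_ker hR hQ hG))

/-- The kernel of an epimorphism from a module of Gorenstein flat dimension at most `n` onto a
Gorenstein flat module. -/
theorem IsSES.hasGFResolution_left (hR : IsLeftGFClosed R) {f : K →ₗ[R] P} {g : P →ₗ[R] G}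
    (h : IsSES f g) {n : ℕ} (hP : HasGFResolution R P n) (hG : IsGorensteinFlat R G) :
    HasGFResolution R K n := by
  cases n with
  | zero =>
    rw [hasGFResolution_zero_iff] at hP ⊢
    exact h.isGorensteinFlat_ker hR hP hG
  | succ n =>
    obtain ⟨P', G', i, p, hip, hG', hP'⟩ := hP.exists_isSES
    obtain ⟨E, a, b, j, hab, hj⟩ := hip.exists_preimage h
    exact hab.hasGFResolution_succ (hj.isGorensteinFlat_ker hR hG' hG) hP'

/-- Any first Gorenstein flat syzygy lowers the Gorenstein flat dimension. Two short exact sequences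
ending in `M` are compared through their pullback, so closure under direct summands is not needed.
-/
theorem IsSES.hasGFResolution_ker (hR : IsLeftGFClosed R) {k : K →ₗ[R] G} {g : G →ₗ[R] M}
    (h : IsSES k g) (hG : IsGorensteinFlat R G) {n : ℕ} (hM : HasGFResolution R M (n + 1)) :
    HasGFResolution R K n := by
  obtain ⟨L, G', l, g', hl, hG', hL⟩ := hM.exists_isSES
  obtain ⟨D, a, b, c, e, hab, hce⟩ := h.exists_pullback hl
  exact hab.hasGFResolution_left hR (hce.hasGFResolution_middle hR hL hG) hG'

theorem HasGFResolution.torZero {n : ℕ} (h : HasGFResolution R M n) {i : ℕ} (hi : n ≤ i)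
    (I : ModuleCat.{u} Rᵐᵒᵖ) (hI : Module.Injective Rᵐᵒᵖ I) : TorZero R i I M := by
  induction n generalizing M i with
  | zero => exact (hasGFResolution_zero_iff.1 h).torZero i I hI
  | succ n ih =>
    obtain ⟨K, G, k, g, hkg, hG, hK⟩ := h.exists_isSES
    obtain ⟨i, rfl⟩ : ∃ j, i = j + 1 := ⟨i - 1, by omega⟩
    exact (hkg.torZero_succ_iff i (hG.torZero _ I hI) (hG.torZero _ I hI)).2 (ih hK (by omega))

/-- A module of finite Gorenstein flat dimension with vanishing Tor against injectives is
Gorenstein flat. -/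
theorem HasGFResolution.isGorensteinFlat (hR : IsLeftGFClosed R) {m : ℕ}
    (h : HasGFResolution R M m)
    (hT : ∀ i, ∀ I : ModuleCat.{u} Rᵐᵒᵖ, Module.Injective Rᵐᵒᵖ I → TorZero R i I M) :
    IsGorensteinFlat R M := by
  induction m generalizing M with
  | zero => exact hasGFResolution_zero_iff.1 h
  | succ m ih =>
    obtain ⟨K, G, k, g, hkg, hG, hK⟩ := h.exists_isSES
    exact hkg.isGorensteinFlat_right hR (ih hK fun i I hI =>
      (hkg.torZero_succ_iff i (hG.torZero _ I hI) (hG.torZero _ I hI)).1 (hT (i + 1) I hI)) hG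
      (hT 0)

theorem HasGFResolution.of_torZero (hR : IsLeftGFClosed R) {m n : ℕ} (h : HasGFResolution R M m)
    (hT : ∀ i, n ≤ i → ∀ I : ModuleCat.{u} Rᵐᵒᵖ, Module.Injective Rᵐᵒᵖ I → TorZero R i I M) :
    HasGFResolution R M n := by
  induction n generalizing M with
  | zero => exact hasGFResolution_zero_iff.2 (h.isGorensteinFlat hR fun i => hT i i.zero_le)
  | succ n ih =>
    have hM := isSES_freeCover R M
    have hF := isFlat_finsupp R M
    exact hM.hasGFResolution_succ hF.isGorensteinFlat
      (ih (hM.hasGFResolution_ker hR hF.isGorensteinFlat (h.mono m.le_succ)) fun i hi I hI =>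
        (hM.torZero_succ_iff i (hF.torZero _ _) (hF.torZero _ _)).1 (hT (i + 1) (by omega) I hI))

theorem HasGFResolution.isGorensteinFlat_last (hR : IsLeftGFClosed R) {n : ℕ}
    (h : HasGFResolution R M n) (S : ExactSeq R M n)
    (hS : ∀ i, i < n → IsGorensteinFlat R (S.G i)) : IsGorensteinFlat R (S.G n) := by
  induction n generalizing M with
  | zero => exact (hasGFResolution_zero_iff.1 h).of_equiv S.equiv.symm
  | succ n ih =>
    exact ih ((isSES_subtype_ker S.aug_surjective).hasGFResolution_ker hR (hS 0 n.succ_pos) h)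
      S.tail fun i hi => hS (i + 1) (by omega)

theorem hasGFResolution_of_forall_exactSeq {n : ℕ} (h : ∀ S : ExactSeq R M n,
    (∀ i, i < n → IsGorensteinFlat R (S.G i)) → IsGorensteinFlat R (S.G n)) :
    HasGFResolution R M n := by
  induction n generalizing M with
  | zero => exact hasGFResolution_zero_iff.2 (h (.self R M 0) fun i hi => by omega)
  | succ n ih =>
    have hM := isSES_freeCover R M
    have hF := (isFlat_finsupp R M).isGorensteinFlat
    refine hM.hasGFResolution_succ hF (ih fun S hS => h (S.cons hM) fun i hi => ?_)
    cases i with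
    | zero => exact hF
    | succ i => exact hS i (by omega)

theorem gfd_eq_iSup {p : ℕ → Prop} (h : ∀ n : ℕ, gfd R M ≤ n ↔ ∀ i, n < i → ¬ p i) :
    gfd R M = ⨆ (i : ℕ) (_ : p i), (i : ℕ∞) := by
  refine eq_of_forall_ge_iff fun c => ?_
  induction c using ENat.recTopCoe with
  | top => simp
  | coe n =>
    rw [h, iSup₂_le_iff]
    refine forall_congr' fun i => ?_
    rw [Nat.cast_le, ← not_lt]
    exact imp_not_comm

end Resolution

end GFDim

theorem theorem2p8 (R : Type u) [Ring R] (hR : GFDim.IsLeftGFClosed R)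
    (M : Type u) [AddCommGroup M] [Module R M] :
    (∀ n : ℕ, List.TFAE [
      GFDim.gfd R M ≤ (n : ℕ∞),
      GFDim.gfd R M < ⊤ ∧ ∀ i : ℕ, n < i → ∀ I : ModuleCat.{u} Rᵐᵒᵖ,
        Module.Injective Rᵐᵒᵖ I → Limits.IsZero (GFDim.Tor R I i M),
      GFDim.gfd R M < ⊤ ∧ ∀ i : ℕ, n < i → ∀ E : ModuleCat.{u} Rᵐᵒᵖ,
        injectiveDimension E < ⊤ → Limits.IsZero (GFDim.Tor R E i M),
      ∀ S : GFDim.ExactSeq R M n, (∀ i, i < n → GFDim.IsGorensteinFlat R (S.G i)) →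
        GFDim.IsGorensteinFlat R (S.G n)]) ∧
    (GFDim.gfd R M < ⊤ →
      GFDim.gfd R M = (⨆ (i : ℕ) (_ : ∃ E : ModuleCat.{u} Rᵐᵒᵖ,
        injectiveDimension E < ⊤ ∧ ¬ Limits.IsZero (GFDim.Tor R E i M)), (i : ℕ∞)) ∧
      GFDim.gfd R M = (⨆ (i : ℕ) (_ : ∃ I : ModuleCat.{u} Rᵐᵒᵖ,
        Module.Injective Rᵐᵒᵖ I ∧ ¬ Limits.IsZero (GFDim.Tor R I i M)), (i : ℕ∞))) := by
  have tfae : ∀ n : ℕ, List.TFAE [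
      GFDim.gfd R M ≤ (n : ℕ∞),
      GFDim.gfd R M < ⊤ ∧ ∀ i : ℕ, n < i → ∀ I : ModuleCat.{u} Rᵐᵒᵖ,
        Module.Injective Rᵐᵒᵖ I → Limits.IsZero (GFDim.Tor R I i M),
      GFDim.gfd R M < ⊤ ∧ ∀ i : ℕ, n < i → ∀ E : ModuleCat.{u} Rᵐᵒᵖ,
        injectiveDimension E < ⊤ → Limits.IsZero (GFDim.Tor R E i M),
      ∀ S : GFDim.ExactSeq R M n, (∀ i, i < n → GFDim.IsGorensteinFlat R (S.G i)) →
        GFDim.IsGorensteinFlat R (S.G n)] := by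
    intro n
    tfae_have 1 → 4 := fun h => (GFDim.gfd_le_iff.1 h).isGorensteinFlat_last hR
    tfae_have 4 → 1 := fun h =>
      GFDim.gfd_le_iff.2 (GFDim.hasGFResolution_of_forall_exactSeq h)
    tfae_have 1 → 3 := fun h => by
      refine ⟨h.trans_lt (ENat.natCast_lt_top n), fun i hi E hE => ?_⟩
      obtain ⟨i, rfl⟩ : ∃ j, i = j + 1 := ⟨i - 1, by omega⟩
      rw [GFDim.isZero_tor_succ_iff]
      exact GFDim.torZero_of_injectiveDimension_lt_top
        (fun i hi => (GFDim.gfd_le_iff.1 h).torZero hi) (by omega) E hE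
    tfae_have 3 → 2 := fun h =>
      ⟨h.1, fun i hi I hI => h.2 i hi I (GFDim.injectiveDimension_lt_top I hI)⟩
    tfae_have 2 → 1 := fun h => by
      obtain ⟨m, hm⟩ := GFDim.gfd_lt_top_iff.1 h.1
      exact GFDim.gfd_le_iff.2 (hm.of_torZero hR fun i hi I hI =>
        (GFDim.isZero_tor_succ_iff i I M).1 (h.2 (i + 1) (by omega) I hI))
    tfae_finish
  refine ⟨tfae, fun hfin => ⟨GFDim.gfd_eq_iSup fun n => ?_, GFDim.gfd_eq_iSup fun n => ?_⟩⟩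
  · refine ((tfae n).out 0 2 rfl rfl).trans ?_
    simp [hfin]
  · refine ((tfae n).out 0 1 rfl rfl).trans ?_
    simp [hfin]
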